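/- Let $H\subset\mathbb{R}^2$ be a compact convex set with non-empty interior, and let $x_{\min}(H)$ and $x_{\max}(H)$ be the minimum and the maximum of the first coordinates of the points of $H$. For a compact set $K\subset\mathbb{R}^2$ whose non-empty intersections with vertical lines are segments, and $x\in[x_{\min}(K),x_{\max}(K)]$, let $V_K(x)=\{x\}\times[\underline y_K(x),\overline y_K(x)]$, where $\underline y_K(x)=\inf\{y:(x,y)\in K\}$ and $\overline y_K(x)=\sup\{y:(x,y)\in K\}$. Put $W_H(x)=\overline y_H(x)-\underline y_H(x)$ for $x\in[x_{\min}(H),x_{\max}(H)]$, and define the shaking and the Steiner symmetrization of $H$ with respect to the $x$-axis by $$H^{\mathsf{Sha}}=\{(x,y): x_{\min}(H)\le x\le x_{\max}(H),\ 0\le y\le W_H(x)\},$$ $$H^{\mathsf{Sym}}=\{(x,y): x_{\min}(H)\le x\le x_{\max}(H),\ |y|\le W_H(x)/2\}.$$ For segments $S_0,\dots,S_{n-1}$ of the plane, let $\langle S_0,\dots,S_{n-1}\rangle$ be the probability that independent random points $U_0,\dots,U_{n-1}$, with $U_j$ uniform on $S_j$ (and $U_j$ equal to the point of $S_j$ if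 $S_j$ is reduced to one point), are in convex position, that is, none of them lies in the convex hull of the others. Then for $N\in\{2,3\}$ and all $x_0<x_1<\dots<x_{N+1}$ in $[x_{\min}(H),x_{\max}(H)]$, $$\langle V_{H^{\mathsf{Sha}}}(x_0),\dots,V_{H^{\mathsf{Sha}}}(x_{N+1})\rangle\le\langle V_H(x_0),\dots,V_H(x_{N+1})\rangle\le\langle V_{H^{\mathsf{Sym}}}(x_0),\dots,V_{H^{\mathsf{Sym}}}(x_{N+1})\rangle .$$ -/

import Mathlib

open MeasureTheory

noncomputable section

/-- The smallest abscissa of a point of `H`. -/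
def xMin (H : Set (ℝ × ℝ)) : ℝ := sInf (Prod.fst '' H)

/-- The largest abscissa of a point of `H`. -/
def xMax (H : Set (ℝ × ℝ)) : ℝ := sSup (Prod.fst '' H)

/-- The smallest ordinate of a point of `H` with abscissa `x`. -/
def yLow (H : Set (ℝ × ℝ)) (x : ℝ) : ℝ := sInf {y : ℝ | (x, y) ∈ H}

/-- The largest ordinate of a point of `H` with abscissa `x`. -/
def yHigh (H : Set (ℝ × ℝ)) (x : ℝ) : ℝ := sSup {y : ℝ | (x, y) ∈ H}

/-- The width function: the length of the vertical slice of `H` at abscissa `x`, and `0` outside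
the range of abscissas. -/
def width (H : Set (ℝ × ℝ)) : ℝ → ℝ :=
  (Set.Icc (xMin H) (xMax H)).indicator fun x => yHigh H x - yLow H x

/-- The vertical slice of `H` at abscissa `x`, given by its two end points; for `H` compact and
convex it is the set of points of `H` with abscissa `x`
(see `segment_verticalSlice`). -/
def verticalSlice (H : Set (ℝ × ℝ)) (x : ℝ) : (ℝ × ℝ) × (ℝ × ℝ) :=
  ((x, yLow H x), (x, yHigh H x))

/-- The Steiner symmetrization of `H` with respect to the `x`-axis. -/
def steinerSym (H : Set (ℝ × ℝ)) : Set (ℝ × ℝ) :=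
  {p | xMin H ≤ p.1 ∧ p.1 ≤ xMax H ∧ |p.2| ≤ width H p.1 / 2}

/-- The shaking of `H` with respect to the `x`-axis. -/
def shaking (H : Set (ℝ × ℝ)) : Set (ℝ × ℝ) :=
  {p | xMin H ≤ p.1 ∧ p.1 ≤ xMax H ∧ 0 ≤ p.2 ∧ p.2 ≤ width H p.1}

/-- The uniform distribution on the segment with end points `S.1` and `S.2` (the Dirac mass if the
two end points are equal). -/
def segmentUniform (S : (ℝ × ℝ) × (ℝ × ℝ)) : Measure (ℝ × ℝ) :=
  (volume.restrict (Set.Icc (0 : ℝ) 1)).map fun t => (1 - t) • S.1 + t • S.2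

instance segmentUniform_isProbabilityMeasure (S : (ℝ × ℝ) × (ℝ × ℝ)) :
    IsProbabilityMeasure (segmentUniform S) := by
  have : IsProbabilityMeasure (volume.restrict (Set.Icc (0 : ℝ) 1)) := ⟨by simp⟩
  exact Measure.isProbabilityMeasure_map (by fun_prop)

/-- The probability that independent points, the `j`-th one uniform on the segment `S j`, are in
convex position, i.e. that no one of them lies in the convex hull of the others. -/
def convexPositionProb {n : ℕ} (S : Fin n → (ℝ × ℝ) × (ℝ × ℝ)) : ℝ :=
  (Measure.pi fun j => segmentUniform (S j)).real {U : Fin n → ℝ × ℝ | ConvexIndependent ℝ U}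

theorem segment_verticalSlice {H : Set (ℝ × ℝ)} (hconv : Convex ℝ H) (hcomp : IsCompact H)
    {x : ℝ} (hx : x ∈ Prod.fst '' H) :
    segment ℝ (verticalSlice H x).1 (verticalSlice H x).2 = {p ∈ H | p.1 = x} := by
  obtain ⟨⟨x', y₀⟩, hp, rfl⟩ := hx
  have hc : IsCompact {y : ℝ | (x', y) ∈ H} := by
    have : {y : ℝ | (x', y) ∈ H} = Prod.snd '' (H ∩ Prod.fst ⁻¹' {x'}) := by
      ext y
      constructor
      · intro hy
        exact ⟨(x', y), ⟨hy, rfl⟩, rfl⟩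
      · rintro ⟨⟨a, b⟩, ⟨h1, h2⟩, rfl⟩
        obtain rfl : a = x' := h2
        exact h1
    rw [this]
    exact (hcomp.inter_right (isClosed_singleton.preimage continuous_fst)).image continuous_snd
  have hne : {y : ℝ | (x', y) ∈ H}.Nonempty := ⟨y₀, hp⟩
  have hlo : (x', yLow H x') ∈ H := hc.sInf_mem hne
  have hhi : (x', yHigh H x') ∈ H := hc.sSup_mem hne
  ext ⟨a, b⟩
  constructor
  · intro h
    refine ⟨hconv.segment_subset hlo hhi h, ?_⟩
    obtain ⟨s, t, -, -, hst, h⟩ := h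
    have h1 := congrArg Prod.fst h
    simp only [verticalSlice, Prod.fst_add, Prod.smul_fst, smul_eq_mul] at h1
    simp only
    rw [← h1, ← add_mul, hst, one_mul]
  · rintro ⟨h, h'⟩
    obtain rfl : a = x' := h'
    have h1 : yLow H a ≤ b := csInf_le hc.bddBelow h
    have h2 : b ≤ yHigh H a := le_csSup hc.bddAbove h
    have h3 : b ∈ segment ℝ (yLow H a) (yHigh H a) := by
      rw [segment_eq_Icc (h1.trans h2)]
      exact ⟨h1, h2⟩
    obtain ⟨s, t, hs, ht, hst, h4⟩ := h3
    refine ⟨s, t, hs, ht, hst, ?_⟩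
    simp only [verticalSlice, Prod.smul_mk, Prod.mk_add_mk, h4]
    rw [← add_smul, hst, one_smul]

end

/-!
The law of the points is transported from the unit cube: the `j`-th point has abscissa `x j` and
ordinate `a j + t j * w j`, where `t j` is uniform on `[0, 1]` and the lengths `w j` of the slices
are the same for the body, its shaking and its Steiner symmetrization. Only the lower ends `a j`
differ.

The absence of convex position is counted by pairs of a point and a triangle containing it. For four
points it means that exactly one of the two middle points lies in the triangle of the others. For
five points, the number of points inside the hull is half the number of pairs of a point and a
triangle containing it, and subtracting `1` when the hull is a triangle gives the indicator function
of the failure of convex position (`GenericPoints.convexInd_five`). These identities follow from the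
fact that the orientations of the four triples out of four points, listed in lexicographic order,
change sign at most once.

The expectations of these counts are explicit. Since the body is convex, the chord between two of
the points, and so the slice of any triangle, stays inside the intermediate segments. Hence a point
lies in a triangle with a conditional probability proportional to the height of that triangle, two
points do with a probability proportional to the square of the height
(`ConvexSlices.integral_mul_triangleInd`), and both the mean height and the mean squared height are
quadratic polynomials `A * δ ^ 2 + B` in the deviation `δ` of the three midpoints from alignment,
with `A` and `B` depending on the abscissas and the lengths only (`ConvexSlices.integral_abs_dev`,
`integral_dev_sq`). The probability of not being in convex position is thus a constant plus a
combination of the `δ ^ 2`. Its coefficients are nonnegative: the only ones to which the squared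
heights contribute negatively are handled in `ConvexSlices.integralLE_triangleInd_pair`, because
triangles that fit in the body have slices shorter than those of the body.

Finally, `δ = 0` for the Steiner symmetrization, and the convexity of the lower boundary and
the concavity of the upper one say precisely that `|δ|` is at most its value for the shaking.
-/

/-! ### Chords and vertical deviations -/

/-- The ordinate at abscissa `x q` of the line through the points of abscissas `x p` and `x r` of
the family of points `(x j, y j)`. -/
noncomputable def chord {ι : Type*} (x y : ι → ℝ) (p q r : ι) : ℝ :=
  ((x r - x q) * y p + (x q - x p) * y r) / (x r - x p)

/-- The signed vertical distance from the line through the `p`-th and the `r`-th of the points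
`(x j, y j)` to the `q`-th one. -/
noncomputable def dev {ι : Type*} (x y : ι → ℝ) (p q r : ι) : ℝ := y q - chord x y p q r

theorem dev_neg {ι : Type*} (x y : ι → ℝ) (p q r : ι) : dev x (-y) p q r = -dev x y p q r := by
  simp only [dev, chord, Pi.neg_apply]
  ring

section Geometry

variable {ι : Type*} [LinearOrder ι] {x : ι → ℝ}

theorem sub_mul_dev (hx : StrictMono x) (y : ι → ℝ) {p r : ι} (q : ι) (h : p < r) :
    (x r - x p) * dev x y p q r =
      (x r - x p) * y q - (x r - x q) * y p - (x q - x p) * y r := by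
  have : x r - x p ≠ 0 := (sub_pos.2 (hx h)).ne'
  unfold dev chord
  field_simp
  ring

/-- If the `i`-th point lies above all the chords that pass over its abscissa, some line through
it leaves all the other points below. -/
theorem exists_slope_of_dev_pos [Fintype ι] (hx : StrictMono x) (y : ι → ℝ) (i : ι)
    (h : ∀ l r, l < i → i < r → 0 < dev x y l i r) :
    ∃ σ : ℝ, ∀ j, j ≠ i → y j - σ * x j < y i - σ * x i := by
  classical
  obtain ⟨σ, h1, h2⟩ := Order.exists_between_finsets
    (((Finset.univ : Finset ι).filter (i < ·)).image fun r => (y r - y i) / (x r - x i))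
    (((Finset.univ : Finset ι).filter (· < i)).image fun l => (y i - y l) / (x i - x l)) (by
      intro u hu v hv
      simp only [Finset.mem_image, Finset.mem_filter, Finset.mem_univ, true_and] at hu hv
      obtain ⟨r, hr, rfl⟩ := hu
      obtain ⟨l, hl, rfl⟩ := hv
      have h0 := sub_mul_dev hx y i (hl.trans hr)
      have h3 := mul_pos (sub_pos.2 (hx (hl.trans hr))) (h l r hl hr)
      rw [div_lt_div_iff₀ (sub_pos.2 (hx hr)) (sub_pos.2 (hx hl))]
      linarith)
  refine ⟨σ, fun j hj => ?_⟩
  rcases lt_or_gt_of_ne hj with hj | hj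
  · have := h2 _ (Finset.mem_image_of_mem _ (by simpa using hj))
    rw [lt_div_iff₀ (sub_pos.2 (hx hj))] at this
    linarith
  · have := h1 _ (Finset.mem_image_of_mem _ (by simpa using hj))
    rw [div_lt_iff₀ (sub_pos.2 (hx hj))] at this
    linarith

theorem chord_mem_convexHull (hx : StrictMono x) (y : ι → ℝ) {l i r : ι} (hl : l < i)
    (hr : i < r) :
    (x i, chord x y l i r) ∈ convexHull ℝ ((fun j => (x j, y j)) '' {j | j ≠ i}) := by
  have h1 := sub_pos.2 (hx hl)
  have h2 := sub_pos.2 (hx hr)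
  have h3 := sub_pos.2 (hx (hl.trans hr))
  refine segment_subset_convexHull (Set.mem_image_of_mem _ hl.ne)
    (Set.mem_image_of_mem _ hr.ne') ?_
  refine ⟨(x r - x i) / (x r - x l), (x i - x l) / (x r - x l), by positivity, by positivity,
    ?_, ?_⟩
  · field_simp
    ring
  · ext
    · simp only [Prod.smul_mk, Prod.mk_add_mk, smul_eq_mul]
      field_simp
      ring
    · simp only [Prod.smul_mk, Prod.mk_add_mk, smul_eq_mul, chord]
      field_simp

/-- Points with distinct abscissas are in convex position if and only if each of them lies
strictly on one and the same side of all the chords that pass over its abscissa. -/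
theorem convexIndependent_iff_dev [Fintype ι] (hx : StrictMono x) (y : ι → ℝ) :
    ConvexIndependent ℝ (fun j => (x j, y j)) ↔
      ∀ i, (∀ l r, l < i → i < r → 0 < dev x y l i r) ∨
        (∀ l r, l < i → i < r → dev x y l i r < 0) := by
  constructor
  · intro h i
    by_contra! hcon
    obtain ⟨⟨l, r, hl, hr, h1⟩, ⟨l', r', hl', hr', h2⟩⟩ := hcon
    have hmem : (x i, y i) ∈ convexHull ℝ ((fun j => (x j, y j)) '' {j | j ≠ i}) := by
      refine (convex_convexHull ℝ _).segment_subset (chord_mem_convexHull hx y hl' hr')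
        (chord_mem_convexHull hx y hl hr) ?_
      rw [← Prod.image_mk_segment_right]
      refine ⟨y i, ?_, rfl⟩
      unfold dev at h1 h2
      rw [segment_eq_Icc (by linarith)]
      constructor <;> linarith
    exact h _ _ hmem rfl
  · intro h
    have key : ∀ i, ∃ f : ℝ × ℝ →ₗ[ℝ] ℝ, ∀ j, j ≠ i → f (x j, y j) < f (x i, y i) := by
      intro i
      rcases h i with h | h
      · obtain ⟨σ, hσ⟩ := exists_slope_of_dev_pos hx y i h
        exact ⟨LinearMap.snd ℝ ℝ ℝ - σ • LinearMap.fst ℝ ℝ ℝ, by simpa using hσ⟩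
      · obtain ⟨σ, hσ⟩ := exists_slope_of_dev_pos hx (-y) i (by
          intro l r hl hr
          rw [dev_neg]
          linarith [h l r hl hr])
        refine ⟨-LinearMap.snd ℝ ℝ ℝ - σ • LinearMap.fst ℝ ℝ ℝ, by simpa using hσ⟩
    rw [convexIndependent_iff_notMem_convexHull_sdiff]
    intro i s hi
    obtain ⟨f, hf⟩ := key i
    have hsub : convexHull ℝ ((fun j => (x j, y j)) '' (s \ {i})) ⊆ {z | f z < f (x i, y i)} := by
      refine convexHull_min ?_ (convex_halfSpace_lt f.isLinear _)
      rintro _ ⟨j, hj, rfl⟩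
      exact hf j hj.2
    exact lt_irrefl (f (x i, y i)) (hsub hi)

end Geometry

/-! ### Integration over the unit cube, one coordinate at a time -/

/-- The uniform distribution on the unit interval. -/
noncomputable def unitUniform : Measure ℝ := volume.restrict (Set.Icc (0 : ℝ) 1)

/-- The uniform distribution on the unit cube. -/
noncomputable def cubeUniform (n : ℕ) : Measure (Fin n → ℝ) := Measure.pi fun _ => unitUniform

instance isProbabilityMeasure_unitUniform : IsProbabilityMeasure unitUniform :=
  ⟨by simp [unitUniform]⟩

instance isProbabilityMeasure_cubeUniform (n : ℕ) : IsProbabilityMeasure (cubeUniform n) := by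
  unfold cubeUniform
  infer_instance

instance nullSingletonClass_unitUniform : NullSingletonClass unitUniform := by
  unfold unitUniform
  infer_instance

theorem cubeUniform_eq_restrict (n : ℕ) :
    cubeUniform n = volume.restrict (Set.univ.pi fun _ => Set.Icc (0 : ℝ) 1) := by
  unfold cubeUniform unitUniform
  rw [volume_pi, Measure.restrict_pi_pi]

theorem ae_cubeUniform_mem_Icc (n : ℕ) :
    ∀ᵐ t ∂cubeUniform n, ∀ j, t j ∈ Set.Icc (0 : ℝ) 1 := by
  rw [cubeUniform_eq_restrict]
  filter_upwards [ae_restrict_mem (MeasurableSet.univ_pi fun _ => measurableSet_Icc)] with t ht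
  exact fun j => ht j (Set.mem_univ j)

theorem Continuous.integrable_cubeUniform {n : ℕ} {f : (Fin n → ℝ) → ℝ} (hf : Continuous f) :
    Integrable f (cubeUniform n) := by
  rw [cubeUniform_eq_restrict]
  exact hf.continuousOn.integrableOn_compact (isCompact_univ_pi fun _ => isCompact_Icc)

theorem integral_unitUniform (f : ℝ → ℝ) : ∫ s, f s ∂unitUniform = ∫ s in (0 : ℝ)..1, f s := by
  rw [unitUniform, integral_Icc_eq_integral_Ioc, intervalIntegral.integral_of_le zero_le_one]

/-- Drawing one coordinate afresh does not change the distribution. -/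
theorem measurePreserving_update {n : ℕ} (i : Fin n) :
    MeasurePreserving (fun p : (Fin n → ℝ) × ℝ => Function.update p.1 i p.2)
      ((cubeUniform n).prod unitUniform) (cubeUniform n) := by
  have hm : Measurable fun p : (Fin n → ℝ) × ℝ => Function.update p.1 i p.2 := by
    fun_prop
  refine ⟨hm, ?_⟩
  symm
  refine Measure.pi_eq fun s hs => ?_
  rw [Measure.map_apply hm (MeasurableSet.univ_pi hs)]
  have : (fun p : (Fin n → ℝ) × ℝ => Function.update p.1 i p.2) ⁻¹' Set.univ.pi s =
      (Set.univ.pi (Function.update s i Set.univ)) ×ˢ s i := by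
    ext ⟨t, u⟩
    simp only [Set.mem_preimage, Set.mem_univ_pi, Set.mem_prod]
    constructor
    · intro h
      refine ⟨fun j => ?_, by simpa using h i⟩
      rcases eq_or_ne j i with rfl | hj
      · simp
      · simpa [hj] using h j
    · rintro ⟨h, h'⟩ j
      rcases eq_or_ne j i with rfl | hj
      · simpa using h'
      · simpa [hj] using h j
  rw [this, Measure.prod_prod, cubeUniform, Measure.pi_pi,
    ← Finset.mul_prod_erase _ _ (Finset.mem_univ i),
    ← Finset.mul_prod_erase Finset.univ (fun j => unitUniform (s j)) (Finset.mem_univ i)]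
  simp only [Function.update_self, measure_univ, one_mul]
  rw [mul_comm]
  congr 1
  refine Finset.prod_congr rfl fun j hj => ?_
  rw [Function.update_of_ne (Finset.ne_of_mem_erase hj)]

theorem integral_cubeUniform_update {n : ℕ} (i : Fin n) {f : (Fin n → ℝ) → ℝ}
    (hf : Integrable f (cubeUniform n)) :
    ∫ t, f t ∂cubeUniform n =
      ∫ t, ∫ s, f (Function.update t i s) ∂unitUniform ∂cubeUniform n := by
  have h := measurePreserving_update i
  rw [← integral_prod (fun p : (Fin n → ℝ) × ℝ => f (Function.update p.1 i p.2))
    (h.integrable_comp_of_integrable hf)]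
  have hf' := hf.aestronglyMeasurable
  rw [← h.map_eq] at hf'
  rw [← integral_map h.measurable.aemeasurable hf', h.map_eq]

theorem ae_cubeUniform_of_update {n : ℕ} (i : Fin n) {P : (Fin n → ℝ) → Prop}
    (hP : MeasurableSet {t | P t})
    (h : ∀ t, ∀ᵐ s ∂unitUniform, P (Function.update t i s)) : ∀ᵐ t ∂cubeUniform n, P t := by
  have h' := measurePreserving_update i
  rw [← h'.map_eq, ae_map_iff h'.measurable.aemeasurable hP]
  exact (Measure.ae_prod_iff_ae_ae (h'.measurable hP)).2 (Filter.Eventually.of_forall h)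

/-! ### Integrals over a segment -/

open Classical in
theorem integral_unitUniform_between {a w c d : ℝ} (hw : 0 < w) (hc : c ∈ Set.Icc a (a + w))
    (hd : d ∈ Set.Icc a (a + w)) :
    ∫ s, (if (a + s * w - c) * (a + s * w - d) < 0 then (1 : ℝ) else 0) ∂unitUniform =
      |c - d| / w := by
  wlog hcd : c ≤ d generalizing c d
  · rw [abs_sub_comm, ← this hd hc (le_of_not_ge hcd)]
    simp only [mul_comm]
  have h1 : (fun s => if (a + s * w - c) * (a + s * w - d) < 0 then (1 : ℝ) else 0) =
      (Set.Ioo ((c - a) / w) ((d - a) / w)).indicator 1 := by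
    ext s
    simp only [Set.indicator_apply, Set.mem_Ioo, Pi.one_apply, div_lt_iff₀ hw, lt_div_iff₀ hw]
    refine if_congr ⟨fun h => ?_, fun h => ?_⟩ rfl rfl
    · rcases mul_neg_iff.1 h with h | h <;> constructor <;> linarith
    · exact mul_neg_of_pos_of_neg (by linarith) (by linarith)
  have h2 : Set.Ioo ((c - a) / w) ((d - a) / w) ∩ Set.Icc 0 1 =
      Set.Ioo ((c - a) / w) ((d - a) / w) := by
    refine Set.inter_eq_left.2 fun s hs => ⟨?_, ?_⟩
    · exact (div_nonneg (by linarith [hc.1]) hw.le).trans hs.1.le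
    · exact hs.2.le.trans ((div_le_one hw).2 (by linarith [hd.2]))
  rw [h1, integral_indicator_one measurableSet_Ioo, measureReal_def, unitUniform,
    Measure.restrict_apply measurableSet_Ioo, h2, Real.volume_Ioo,
    ENNReal.toReal_ofReal (sub_nonneg.2 (by gcongr)), abs_sub_comm, abs_of_nonneg (by linarith)]
  ring

theorem integral_abs_sub_unit {c : ℝ} (hc : c ∈ Set.Icc (0 : ℝ) 1) :
    ∫ s, |s - c| ∂unitUniform = 1 / 4 + (c - 1 / 2) ^ 2 := by
  have hi : ∀ u v : ℝ, IntervalIntegrable (fun s => |s - c|) volume u v := fun u v =>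
    (by fun_prop : Continuous fun s => |s - c|).intervalIntegrable u v
  rw [integral_unitUniform, ← intervalIntegral.integral_add_adjacent_intervals (hi 0 c) (hi c 1)]
  have h1 : ∫ s in (0 : ℝ)..c, |s - c| = ∫ s in (0 : ℝ)..c, (c - s) := by
    refine intervalIntegral.integral_congr fun s hs => ?_
    rw [Set.uIcc_of_le hc.1] at hs
    rw [abs_sub_comm, abs_of_nonneg (by linarith [hs.2])]
  have h2 : ∫ s in c..1, |s - c| = ∫ s in c..1, (s - c) := by
    refine intervalIntegral.integral_congr fun s hs => ?_
    rw [Set.uIcc_of_le hc.2] at hs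
    exact abs_of_nonneg (by linarith [hs.1])
  rw [h1, h2]
  have h3 : ∀ u v : ℝ, IntervalIntegrable (fun _ => c) volume u v := fun u v =>
    continuous_const.intervalIntegrable u v
  have h4 : ∀ u v : ℝ, IntervalIntegrable (fun s => s) volume u v := fun u v =>
    continuous_id.intervalIntegrable u v
  rw [intervalIntegral.integral_sub (h3 0 c) (h4 0 c),
    intervalIntegral.integral_sub (h4 c 1) (h3 c 1)]
  simp only [intervalIntegral.integral_const, integral_id, smul_eq_mul]
  ring

/-- The mean distance from a uniform point of a segment to a point of the segment is a quadratic
function of the latter. -/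
theorem integral_abs_sub_segment {a w c : ℝ} (hw : 0 < w) (hc : c ∈ Set.Icc a (a + w)) :
    ∫ s, |a + s * w - c| ∂unitUniform = w / 4 + (c - (a + w / 2)) ^ 2 / w := by
  have h : ∀ s, |a + s * w - c| = w * |s - (c - a) / w| := by
    intro s
    conv_rhs => rw [← abs_of_pos hw, ← abs_mul, abs_of_pos hw]
    congr 1
    field_simp
    ring
  simp only [h]
  rw [integral_const_mul, integral_abs_sub_unit
    ⟨div_nonneg (by linarith [hc.1]) hw.le, (div_le_one hw).2 (by linarith [hc.2])⟩]
  field_simp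
  ring

theorem integral_cubeUniform_coord {n : ℕ} (j : Fin n) :
    ∫ t, t j ∂cubeUniform n = 1 / 2 := by
  rw [integral_cubeUniform_update j (continuous_apply j).integrable_cubeUniform]
  simp [integral_unitUniform]

/-! ### Random points on vertical segments -/

/-- The ordinates of points on the vertical segments with lower ends `a j` and lengths `w j`, as a
function of their relative positions `t j` on these segments. -/
def ordinate {n : ℕ} (a w t : Fin n → ℝ) (j : Fin n) : ℝ := a j + t j * w j

/-- The ordinates of the midpoints of the vertical segments with lower ends `a j` and lengths
`w j`. -/
noncomputable def midOrdinate {n : ℕ} (a w : Fin n → ℝ) (j : Fin n) : ℝ := a j + w j / 2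

/-- Vertical segments with abscissas `x j`, lower ends `a j` and lengths `w j` that are the slices
of a convex set: the lower ends are in convex position, the upper ends in concave position, and the
segments other than the two extreme ones are not reduced to a point. -/
structure ConvexSlices {n : ℕ} (x a w : Fin n → ℝ) : Prop where
  strictMono : StrictMono x
  nonneg : ∀ j, 0 ≤ w j
  pos : ∀ p q r, p < q → q < r → 0 < w q
  lower : ∀ p q r, p < q → q < r → dev x a p q r ≤ 0
  upper : ∀ p q r, p < q → q < r → 0 ≤ dev x (fun j => a j + w j) p q r

/-- The height at abscissa `x i` of the triangle over the base `[x p, x r]` whose apex, of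
height `1`, has abscissa `x q`. -/
noncomputable def tent {ι : Type*} (x : ι → ℝ) (p q r i : ι) : ℝ :=
  min ((x i - x p) / (x q - x p)) ((x r - x i) / (x r - x q))

/-- The `i`-th point lies strictly inside the triangle with vertices the `p`-th, `q`-th and `r`-th
points: at abscissa `x i`, it lies between the long side of the triangle and the union of the
other two sides. -/
def InTriangle {ι : Type*} (x y : ι → ℝ) (p q r i : ι) : Prop :=
  dev x y p i r * (dev x y p i r - tent x p q r i * dev x y p q r) < 0

open Classical in
/-- The indicator function of `InTriangle`. -/
noncomputable def triangleInd {ι : Type*} (x y : ι → ℝ) (p q r i : ι) : ℝ :=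
  if InTriangle x y p q r i then 1 else 0

section Algebra

variable {n : ℕ} {x : Fin n → ℝ}

theorem chord_add_tent_mul_dev_of_lt (hx : StrictMono x) (y : Fin n → ℝ) {p q r i : Fin n}
    (h1 : p < i) (h2 : i < q) (h3 : q < r) :
    chord x y p i r + tent x p q r i * dev x y p q r = chord x y p i q := by
  have e1 := sub_pos.2 (hx h1)
  have e2 := sub_pos.2 (hx h2)
  have e3 := sub_pos.2 (hx h3)
  have e4 := sub_pos.2 (hx (h1.trans h2))
  have e5 := sub_pos.2 (hx ((h1.trans h2).trans h3))
  have ht : tent x p q r i = (x i - x p) / (x q - x p) := by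
    refine min_eq_left (((div_le_one e4).2 (by linarith)).trans ((one_le_div e3).2 (by linarith)))
  rw [ht]
  unfold dev chord
  field_simp
  ring

theorem chord_add_tent_mul_dev_of_gt (hx : StrictMono x) (y : Fin n → ℝ) {p q r i : Fin n}
    (h1 : p < q) (h2 : q < i) (h3 : i < r) :
    chord x y p i r + tent x p q r i * dev x y p q r = chord x y q i r := by
  have e1 := sub_pos.2 (hx h1)
  have e2 := sub_pos.2 (hx h2)
  have e3 := sub_pos.2 (hx h3)
  have e4 := sub_pos.2 (hx (h2.trans h3))
  have e5 := sub_pos.2 (hx ((h1.trans h2).trans h3))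
  have ht : tent x p q r i = (x r - x i) / (x r - x q) := by
    refine min_eq_right (((div_le_one e4).2 (by linarith)).trans ((one_le_div e1).2 (by linarith)))
  rw [ht]
  unfold dev chord
  field_simp
  ring

theorem tent_pos (hx : StrictMono x) {p q r i : Fin n} (h1 : p < q) (h2 : q < r) (h3 : p < i)
    (h4 : i < r) : 0 < tent x p q r i :=
  lt_min (div_pos (sub_pos.2 (hx h3)) (sub_pos.2 (hx h1)))
    (div_pos (sub_pos.2 (hx h4)) (sub_pos.2 (hx h2)))

theorem chord_mono (hx : StrictMono x) {y z : Fin n → ℝ} (h : ∀ j, y j ≤ z j) {p q r : Fin n}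
    (h1 : p < q) (h2 : q < r) : chord x y p q r ≤ chord x z p q r := by
  have e1 := sub_pos.2 (hx h1)
  have e2 := sub_pos.2 (hx h2)
  have e3 := sub_pos.2 (hx (h1.trans h2))
  unfold chord
  gcongr
  · exact h p
  · exact h r

theorem chord_add (x y z : Fin n → ℝ) (p q r : Fin n) :
    chord x (fun j => y j + z j) p q r = chord x y p q r + chord x z p q r := by
  unfold chord
  ring

theorem dev_add (x y z : Fin n → ℝ) (p q r : Fin n) :
    dev x (fun j => y j + z j) p q r = dev x y p q r + dev x z p q r := by
  unfold dev
  rw [chord_add]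
  ring

theorem ordinate_eq_mid_add (a w t : Fin n → ℝ) :
    ordinate a w t = fun j => midOrdinate a w j + ordinate (fun k => -(w k / 2)) w t j := by
  ext j
  unfold ordinate midOrdinate
  ring

theorem ordinate_update (a w t : Fin n → ℝ) (i : Fin n) (s : ℝ) :
    ordinate a w (Function.update t i s) = Function.update (ordinate a w t) i (a i + s * w i) := by
  ext j
  rcases eq_or_ne j i with rfl | h
  · simp [ordinate]
  · simp [ordinate, h]

theorem chord_update (y : Fin n → ℝ) {p r i : Fin n} (q : Fin n) (v : ℝ) (hp : p ≠ i)
    (hr : r ≠ i) : chord x (Function.update y i v) p q r = chord x y p q r := by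
  simp [chord, hp, hr]

theorem dev_update_self (y : Fin n → ℝ) {p r i : Fin n} (v : ℝ) (hp : p ≠ i) (hr : r ≠ i) :
    dev x (Function.update y i v) p i r = v - chord x y p i r := by
  simp [dev, chord_update y i v hp hr]

theorem dev_update_of_ne (y : Fin n → ℝ) {p q r i : Fin n} (v : ℝ) (hp : p ≠ i) (hq : q ≠ i)
    (hr : r ≠ i) : dev x (Function.update y i v) p q r = dev x y p q r := by
  simp [dev, chord_update y q v hp hr, hq]

theorem triangleInd_update_of_ne (y : Fin n → ℝ) {p q r i k : Fin n} (v : ℝ) (hp : p ≠ k)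
    (hq : q ≠ k) (hr : r ≠ k) (hi : i ≠ k) :
    triangleInd x (Function.update y k v) p q r i = triangleInd x y p q r i := by
  unfold triangleInd InTriangle
  rw [dev_update_of_ne y v hp hq hr, dev_update_of_ne y v hp hi hr]

theorem continuous_dev_ordinate (x a w : Fin n → ℝ) (p q r : Fin n) :
    Continuous fun t => dev x (ordinate a w t) p q r := by
  unfold dev chord ordinate
  fun_prop

theorem continuous_chord_ordinate (x a w : Fin n → ℝ) (p q r : Fin n) :
    Continuous fun t => chord x (ordinate a w t) p q r := by
  unfold chord ordinate
  fun_prop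

theorem measurable_triangleInd (x a w : Fin n → ℝ) (p q r i : Fin n) :
    Measurable fun t => triangleInd x (ordinate a w t) p q r i := by
  unfold triangleInd
  refine Measurable.ite ?_ measurable_const measurable_const
  exact (isOpen_lt (((continuous_dev_ordinate x a w p i r)).mul
    ((continuous_dev_ordinate x a w p i r).sub
      (continuous_const.mul (continuous_dev_ordinate x a w p q r)))) continuous_const).measurableSet

theorem norm_triangleInd_le_one (x y : Fin n → ℝ) (p q r i : Fin n) :
    ‖triangleInd x y p q r i‖ ≤ 1 := by
  unfold triangleInd
  split_ifs <;> simp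

theorem MeasureTheory.Integrable.mul_triangleInd {f : (Fin n → ℝ) → ℝ}
    (hf : Integrable f (cubeUniform n)) (x a w : Fin n → ℝ) (p q r i : Fin n) :
    Integrable (fun t => f t * triangleInd x (ordinate a w t) p q r i) (cubeUniform n) :=
  hf.mul_bdd (c := 1) (measurable_triangleInd x a w p q r i).aestronglyMeasurable
    (Filter.Eventually.of_forall fun _ => norm_triangleInd_le_one _ _ _ _ _ _)

theorem integrable_triangleInd (x a w : Fin n → ℝ) (p q r i : Fin n) :
    Integrable (fun t => triangleInd x (ordinate a w t) p q r i) (cubeUniform n) := by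
  simpa using (integrable_const (1 : ℝ)).mul_triangleInd x a w p q r i

end Algebra

namespace ConvexSlices

variable {n : ℕ} {x a w : Fin n → ℝ}

/-- By convexity, a chord of the configuration meets the intermediate segments. -/
theorem chord_mem_Icc (H : ConvexSlices x a w) {t : Fin n → ℝ}
    (ht : ∀ j, t j ∈ Set.Icc (0 : ℝ) 1) {p q r : Fin n} (h1 : p < q) (h2 : q < r) :
    chord x (ordinate a w t) p q r ∈ Set.Icc (a q) (a q + w q) := by
  have e1 := H.lower p q r h1 h2
  have e2 := H.upper p q r h1 h2
  have e3 := chord_mono H.strictMono (y := a) (z := ordinate a w t)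
    (fun j => le_add_of_nonneg_right (mul_nonneg (ht j).1 (H.nonneg j))) h1 h2
  have e4 := chord_mono H.strictMono (y := ordinate a w t) (z := fun j => a j + w j)
    (fun j => by
      have := mul_le_mul_of_nonneg_right (ht j).2 (H.nonneg j)
      simp only [ordinate]
      linarith) h1 h2
  unfold dev at e1 e2
  constructor <;> linarith

theorem tent_mul_le (H : ConvexSlices x a w) {p q r i : Fin n} (h1 : p < q) (h2 : q < r)
    (h3 : p < i) (h4 : i < r) (hi : i ≠ q) : tent x p q r i * w q ≤ w i := by
  have hd : ∀ {p q r : Fin n}, p < q → q < r → 0 ≤ dev x w p q r := by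
    intro p q r h1 h2
    have e1 := H.lower p q r h1 h2
    have e2 := H.upper p q r h1 h2
    rw [dev_add] at e2
    linarith
  -- the chord of the widths from the apex to the base dominates the one that drops to zero
  rcases lt_or_gt_of_ne hi with h | h
  · refine (mul_le_mul_of_nonneg_right (min_le_left _ _) (H.nonneg q)).trans
      (le_trans ?_ (sub_nonneg.1 (hd h3 h)))
    have e1 := sub_pos.2 (H.strictMono h1)
    have e2 := sub_pos.2 (H.strictMono h)
    have := mul_nonneg e2.le (H.nonneg p)
    unfold chord
    rw [div_mul_eq_mul_div]
    gcongr
    linarith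
  · refine (mul_le_mul_of_nonneg_right (min_le_right _ _) (H.nonneg q)).trans
      (le_trans ?_ (sub_nonneg.1 (hd h h4)))
    have e1 := sub_pos.2 (H.strictMono h2)
    have e2 := sub_pos.2 (H.strictMono h)
    have := mul_nonneg e2.le (H.nonneg r)
    unfold chord
    rw [div_mul_eq_mul_div]
    gcongr
    linarith

/-- Conditionally on the other points, the `i`-th point falls into the triangle `p q r` with
probability the length of its slice of the triangle over the length of its segment. -/
theorem integral_mul_triangleInd (H : ConvexSlices x a w) {p q r i : Fin n} (h1 : p < q)
    (h2 : q < r) (h3 : p < i) (h4 : i < r) (hi : i ≠ q) {f : (Fin n → ℝ) → ℝ}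
    (hf : Integrable f (cubeUniform n)) (hfi : ∀ t s, f (Function.update t i s) = f t) :
    ∫ t, f t * triangleInd x (ordinate a w t) p q r i ∂cubeUniform n =
      ∫ t, f t * (tent x p q r i / w i * |dev x (ordinate a w t) p q r|) ∂cubeUniform n := by
  rw [integral_cubeUniform_update i (hf.mul_triangleInd x a w p q r i)]
  refine integral_congr_ae ?_
  filter_upwards [ae_cubeUniform_mem_Icc n] with t ht
  simp only [hfi, triangleInd, InTriangle, ordinate_update]
  rw [integral_const_mul]
  simp only [dev_update_self (ordinate a w t) _ h3.ne h4.ne', sub_sub,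
    dev_update_of_ne (ordinate a w t) _ h3.ne hi.symm h4.ne']
  rw [integral_unitUniform_between (H.pos p i r h3 h4) (H.chord_mem_Icc ht h3 h4)]
  · rw [sub_add_cancel_left, abs_neg, abs_mul, abs_of_pos (tent_pos H.strictMono h1 h2 h3 h4)]
    ring
  · rcases lt_or_gt_of_ne hi with h | h
    · rw [chord_add_tent_mul_dev_of_lt H.strictMono _ h3 h h2]
      exact H.chord_mem_Icc ht h3 h
    · rw [chord_add_tent_mul_dev_of_gt H.strictMono _ h1 h h4]
      exact H.chord_mem_Icc ht h h4

theorem integral_triangleInd (H : ConvexSlices x a w) {p q r i : Fin n} (h1 : p < q)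
    (h2 : q < r) (h3 : p < i) (h4 : i < r) (hi : i ≠ q) :
    ∫ t, triangleInd x (ordinate a w t) p q r i ∂cubeUniform n =
      tent x p q r i / w i * ∫ t, |dev x (ordinate a w t) p q r| ∂cubeUniform n := by
  have := H.integral_mul_triangleInd h1 h2 h3 h4 hi (f := fun _ => 1) (integrable_const _)
    (fun _ _ => rfl)
  simpa only [one_mul, integral_const_mul] using this

theorem integral_triangleInd_mul_triangleInd (H : ConvexSlices x a w) {p q r i k : Fin n}
    (h1 : p < q) (h2 : q < r) (h3 : p < i) (h4 : i < r) (hi : i ≠ q) (h5 : p < k) (h6 : k < r)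
    (hk : k ≠ q) (hik : i ≠ k) :
    ∫ t, triangleInd x (ordinate a w t) p q r i * triangleInd x (ordinate a w t) p q r k
        ∂cubeUniform n =
      tent x p q r i / w i * (tent x p q r k / w k) *
        ∫ t, dev x (ordinate a w t) p q r ^ 2 ∂cubeUniform n := by
  have hc := (continuous_dev_ordinate x a w p q r).abs
  rw [H.integral_mul_triangleInd h1 h2 h5 h6 hk (integrable_triangleInd x a w p q r i) (by
    intro t s
    rw [ordinate_update, triangleInd_update_of_ne _ _ h5.ne hk.symm h6.ne' hik])]
  simp only [mul_comm (triangleInd _ _ _ _ _ _)]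
  rw [H.integral_mul_triangleInd h1 h2 h3 h4 hi
    (f := fun t => tent x p q r k / w k * |dev x (ordinate a w t) p q r|)
    (continuous_const.mul hc).integrable_cubeUniform (by
      intro t s
      rw [ordinate_update, dev_update_of_ne _ _ h3.ne hi.symm h4.ne']), ← integral_const_mul]
  congr 1
  ext t
  rw [← sq_abs (dev x (ordinate a w t) p q r)]
  ring

end ConvexSlices

/-! ### Moments of the height of a random triangle -/

section Moments

variable {n : ℕ}

theorem integral_ordinate_centered (w : Fin n → ℝ) (j : Fin n) :
    ∫ t, ordinate (fun k => -(w k / 2)) w t j ∂cubeUniform n = 0 := by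
  have hc : Continuous fun t : Fin n → ℝ => t j * w j := by fun_prop
  unfold ordinate
  rw [integral_add (integrable_const _) hc.integrable_cubeUniform, integral_mul_const,
    integral_cubeUniform_coord]
  simp only [integral_const, probReal_univ, one_smul]
  ring

theorem integral_chord_centered (x w : Fin n → ℝ) (p q r : Fin n) :
    ∫ t, chord x (ordinate (fun k => -(w k / 2)) w t) p q r ∂cubeUniform n = 0 := by
  have hc : ∀ (c : ℝ) (j : Fin n),
      Continuous fun t => c * ordinate (fun k => -(w k / 2)) w t j := by
    intro c j
    unfold ordinate
    fun_prop
  unfold chord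
  rw [integral_div, integral_add (hc _ p).integrable_cubeUniform
    (hc _ r).integrable_cubeUniform, integral_const_mul, integral_const_mul,
    integral_ordinate_centered, integral_ordinate_centered]
  simp

theorem integral_dev_centered (x w : Fin n → ℝ) (p q r : Fin n) :
    ∫ t, dev x (ordinate (fun k => -(w k / 2)) w t) p q r ∂cubeUniform n = 0 := by
  unfold dev
  rw [integral_sub _ (continuous_chord_ordinate _ _ _ _ _ _).integrable_cubeUniform,
    integral_ordinate_centered, integral_chord_centered, sub_zero]
  refine Continuous.integrable_cubeUniform ?_
  unfold ordinate
  fun_prop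

theorem integral_add_sq_of_integral_eq_zero {f : (Fin n → ℝ) → ℝ} (hf : Continuous f)
    (h0 : ∫ t, f t ∂cubeUniform n = 0) (c : ℝ) :
    ∫ t, (c + f t) ^ 2 ∂cubeUniform n = c ^ 2 + ∫ t, f t ^ 2 ∂cubeUniform n := by
  have h : ∀ t, (c + f t) ^ 2 = c ^ 2 + (2 * c * f t + f t ^ 2) := fun t => by ring
  have h1 : Continuous fun t => 2 * c * f t := by fun_prop
  have h2 : Continuous fun t => f t ^ 2 := by fun_prop
  simp only [h]
  rw [integral_add (integrable_const _) (h1.fun_add h2).integrable_cubeUniform,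
    integral_add h1.integrable_cubeUniform h2.integrable_cubeUniform, integral_const_mul, h0]
  simp

theorem integral_dev_sq (x a w : Fin n → ℝ) (p q r : Fin n) :
    ∫ t, dev x (ordinate a w t) p q r ^ 2 ∂cubeUniform n =
      dev x (midOrdinate a w) p q r ^ 2 +
        ∫ t, dev x (ordinate (fun k => -(w k / 2)) w t) p q r ^ 2 ∂cubeUniform n := by
  rw [← integral_add_sq_of_integral_eq_zero (continuous_dev_ordinate _ _ _ _ _ _)
    (integral_dev_centered x w p q r)]
  congr 1
  ext t
  rw [ordinate_eq_mid_add, dev_add]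

/-- As a function of the position of the segments, the mean height of a random triangle is a
quadratic polynomial in the deviation of the midpoints: the apex is uniform on a segment that the
base always crosses. -/
theorem ConvexSlices.integral_abs_dev {x a w : Fin n → ℝ} (H : ConvexSlices x a w) {p q r : Fin n}
    (h1 : p < q) (h2 : q < r) :
    ∫ t, |dev x (ordinate a w t) p q r| ∂cubeUniform n =
      dev x (midOrdinate a w) p q r ^ 2 / w q + (w q / 4 +
        (∫ t, chord x (ordinate (fun k => -(w k / 2)) w t) p q r ^ 2 ∂cubeUniform n) / w q) := by
  have hw := H.pos p q r h1 h2
  have hc := continuous_chord_ordinate x (fun k => -(w k / 2)) w p q r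
  have hstep : ∫ t, |dev x (ordinate a w t) p q r| ∂cubeUniform n =
      ∫ t, (w q / 4 + (-dev x (midOrdinate a w) p q r +
        chord x (ordinate (fun k => -(w k / 2)) w t) p q r) ^ 2 / w q) ∂cubeUniform n := by
    rw [integral_cubeUniform_update q
      (continuous_dev_ordinate x a w p q r).abs.integrable_cubeUniform]
    refine integral_congr_ae ?_
    filter_upwards [ae_cubeUniform_mem_Icc n] with t ht
    simp only [ordinate_update, dev_update_self (ordinate a w t) _ h1.ne h2.ne']
    rw [integral_abs_sub_segment hw (H.chord_mem_Icc ht h1 h2), ordinate_eq_mid_add, chord_add]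
    simp only [dev, midOrdinate]
    ring
  have hs : Continuous fun t => (-dev x (midOrdinate a w) p q r +
      chord x (ordinate (fun k => -(w k / 2)) w t) p q r) ^ 2 / w q := by
    fun_prop
  rw [hstep, integral_add (integrable_const _) hs.integrable_cubeUniform,
    integral_div (w q) fun t => (-dev x (midOrdinate a w) p q r +
      chord x (ordinate (fun k => -(w k / 2)) w t) p q r) ^ 2,
    integral_add_sq_of_integral_eq_zero hc (integral_chord_centered x w p q r)]
  simp only [integral_const, probReal_univ, smul_eq_mul]
  ring

end Moments

/-! ### Orientations of triples of points -/

section Orientation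

variable {n : ℕ} {x y : Fin n → ℝ}

open Classical in
/-- The orientation of a triple of points: whether the middle one lies above the chord between the
other two. -/
noncomputable def isAbove {ι : Type*} (x y : ι → ℝ) (p q r : ι) : Bool :=
  decide (0 < dev x y p q r)

/-- No three of the points are aligned. -/
def GenericPoints (x y : Fin n → ℝ) : Prop := ∀ p q r, p < q → q < r → dev x y p q r ≠ 0

/-- The condition on the orientations `a`, `b`, `c`, `d` of the triples `pqr`, `pqs`, `prs`, `qrs`
of four points `p < q < r < s` that at most one change of sign occurs along the list. -/
def AtMostOneChange (a b c d : Bool) : Prop :=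
  (a = c → b = a) ∧ (a = d → b = a) ∧ (a = d → c = a) ∧ (b = d → c = b)

instance (a b c d : Bool) : Decidable (AtMostOneChange a b c d) := by
  unfold AtMostOneChange
  infer_instance

theorem decide_pos_eq_of_linear_relation {A B C α β γ : ℝ} (hα : 0 < α) (hβ : 0 < β) (hγ : 0 < γ)
    (hA : A ≠ 0) (hC : C ≠ 0) (h : α * A - β * B + γ * C = 0) :
    decide (0 < A) = decide (0 < C) → decide (0 < B) = decide (0 < A) := by
  intro hAC
  rw [decide_eq_decide] at hAC ⊢
  rcases lt_or_gt_of_ne hA with hA | hA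
  · have hC' : C < 0 := lt_of_le_of_ne (not_lt.1 fun hc => absurd (hAC.2 hc) hA.not_gt) hC
    have h1 := mul_neg_of_pos_of_neg hα hA
    have h2 := mul_neg_of_pos_of_neg hγ hC'
    have h3 : ¬ 0 < B := fun hB => by
      have := mul_pos hβ hB
      linarith
    exact iff_of_false h3 hA.not_gt
  · have h1 := mul_pos hα hA
    have h2 := mul_pos hγ (hAC.1 hA)
    exact iff_of_true (pos_of_mul_pos_right (by linarith : 0 < β * B) hβ.le) hA

theorem GenericPoints.atMostOneChange (hy : GenericPoints x y) (hx : StrictMono x)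
    {p q r s : Fin n} (h1 : p < q) (h2 : q < r) (h3 : r < s) :
    AtMostOneChange (isAbove x y p q r) (isAbove x y p q s) (isAbove x y p r s)
      (isAbove x y q r s) := by
  have e1 := sub_pos.2 (hx h1)
  have e2 := sub_pos.2 (hx h2)
  have e3 := sub_pos.2 (hx h3)
  have e4 := sub_pos.2 (hx (h1.trans h2))
  have e5 := sub_pos.2 (hx (h2.trans h3))
  have e6 := sub_pos.2 (hx ((h1.trans h2).trans h3))
  have d1 := sub_mul_dev hx y q (h1.trans h2)
  have d2 := sub_mul_dev hx y q ((h1.trans h2).trans h3)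
  have d3 := sub_mul_dev hx y r ((h1.trans h2).trans h3)
  have d4 := sub_mul_dev hx y r (h2.trans h3)
  have n1 := hy p q r h1 h2
  have n2 := hy p q s h1 (h2.trans h3)
  have n4 := hy q r s h2 h3
  have n3 := hy p r s (h1.trans h2) h3
  -- the four linear relations are those between the areas of three faces of the quadruple
  refine ⟨?_, ?_, ?_, ?_⟩
  · exact decide_pos_eq_of_linear_relation (mul_pos e6 e4) (mul_pos e4 e6) (mul_pos e1 e6) n1 n3 (by
      linear_combination (x s - x p) * d1 - (x r - x p) * d2 + (x q - x p) * d3)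
  · exact decide_pos_eq_of_linear_relation (mul_pos e5 e4) (mul_pos e2 e6) (mul_pos e1 e5) n1 n4 (by
      linear_combination (x s - x q) * d1 - (x r - x q) * d2 + (x q - x p) * d4)
  · exact decide_pos_eq_of_linear_relation (mul_pos e3 e4) (mul_pos e2 e6) (mul_pos e4 e5) n1 n4 (by
      linear_combination (x s - x r) * d1 - (x r - x q) * d3 + (x r - x p) * d4)
  · exact decide_pos_eq_of_linear_relation (mul_pos e3 e6) (mul_pos e5 e6) (mul_pos e6 e5) n2 n4 (by
      linear_combination (x s - x r) * d2 - (x s - x q) * d3 + (x s - x p) * d4)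

theorem GenericPoints.mul_neg_iff (hy : GenericPoints x y) {p q r p' q' r' : Fin n} (h1 : p < q)
    (h2 : q < r) (h3 : p' < q') (h4 : q' < r') :
    dev x y p q r * dev x y p' q' r' < 0 ↔ isAbove x y p q r ≠ isAbove x y p' q' r' := by
  have n1 := hy p q r h1 h2
  have n2 := hy p' q' r' h3 h4
  rw [isAbove, isAbove, ne_eq, decide_eq_decide, _root_.mul_neg_iff]
  rcases lt_or_gt_of_ne n1 with n1 | n1 <;> rcases lt_or_gt_of_ne n2 with n2 | n2 <;>
    simp [n1, n2, n1.not_gt, n2.not_gt]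

theorem GenericPoints.triangleInd_of_lt (hy : GenericPoints x y) (hx : StrictMono x)
    {p q r i : Fin n} (h1 : p < i) (h2 : i < q) (h3 : q < r) :
    triangleInd x y p q r i = ((isAbove x y p i q ^^ isAbove x y p i r).toNat : ℝ) := by
  have h : InTriangle x y p q r i ↔ isAbove x y p i r ≠ isAbove x y p i q := by
    rw [InTriangle, ← hy.mul_neg_iff h1 (h2.trans h3) h1 h2]
    nth_rw 2 [dev]
    rw [sub_sub, chord_add_tent_mul_dev_of_lt hx y h1 h2 h3, ← dev]
  classical
  rw [triangleInd, if_congr h rfl rfl]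
  cases isAbove x y p i q <;> cases isAbove x y p i r <;> simp

theorem GenericPoints.triangleInd_of_gt (hy : GenericPoints x y) (hx : StrictMono x)
    {p q r i : Fin n} (h1 : p < q) (h2 : q < i) (h3 : i < r) :
    triangleInd x y p q r i = ((isAbove x y q i r ^^ isAbove x y p i r).toNat : ℝ) := by
  have h : InTriangle x y p q r i ↔ isAbove x y p i r ≠ isAbove x y q i r := by
    rw [InTriangle, ← hy.mul_neg_iff (h1.trans h2) h3 h2 h3]
    nth_rw 2 [dev]
    rw [sub_sub, chord_add_tent_mul_dev_of_gt hx y h1 h2 h3, ← dev]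
  classical
  rw [triangleInd, if_congr h rfl rfl]
  cases isAbove x y q i r <;> cases isAbove x y p i r <;> simp

/-- The points are in convex position, expressed by means of `dev`
(see `convexIndependent_iff_dev`). -/
def InConvexPosition (x y : Fin n → ℝ) : Prop :=
  ∀ i, (∀ l r, l < i → i < r → 0 < dev x y l i r) ∨ (∀ l r, l < i → i < r → dev x y l i r < 0)

open Classical in
/-- The indicator function of `InConvexPosition`. -/
noncomputable def convexInd (x y : Fin n → ℝ) : ℝ := if InConvexPosition x y then 1 else 0

theorem GenericPoints.inConvexPosition_iff (hy : GenericPoints x y) :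
    InConvexPosition x y ↔ ∀ i, (∀ l r, l < i → i < r → isAbove x y l i r = true) ∨
      (∀ l r, l < i → i < r → isAbove x y l i r = false) := by
  refine forall_congr' fun i => or_congr ?_ ?_
  · simp only [isAbove, decide_eq_true_eq]
  · refine forall₄_congr fun l r hl hr => ?_
    simp only [isAbove, decide_eq_false_iff_not, not_lt]
    exact ⟨le_of_lt, fun h => lt_of_le_of_ne h (hy l i r hl hr)⟩

theorem GenericPoints.convexInd_eq (hy : GenericPoints x y) {b : Bool}
    (h : (∀ i, (∀ l r, l < i → i < r → isAbove x y l i r = true) ∨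
      (∀ l r, l < i → i < r → isAbove x y l i r = false)) ↔ b = true) :
    convexInd x y = (b.toNat : ℝ) := by
  classical
  rw [convexInd, if_congr (hy.inConvexPosition_iff.trans h) rfl rfl]
  cases b <;> simp

/-- Four points fail to be in convex position when one of the two middle ones lies in the triangle
of the other points, and these two events exclude each other. -/
theorem GenericPoints.convexInd_four {x y : Fin 4 → ℝ} (hy : GenericPoints x y)
    (hx : StrictMono x) :
    convexInd x y = 1 - (triangleInd x y 0 2 3 1 + triangleInd x y 0 1 3 2) := by
  have hb : ∀ a b c d : Bool, AtMostOneChange a b c d →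
      ((a == b) && (c == d)).toNat + ((a ^^ b).toNat + (d ^^ c).toNat) = 1 := by
    decide
  have h := hb _ _ _ _ (hy.atMostOneChange hx (p := 0) (q := 1) (r := 2) (s := 3) (by decide)
    (by decide) (by decide))
  have hc := hy.convexInd_eq (b := (isAbove x y 0 1 2 == isAbove x y 0 1 3) &&
      (isAbove x y 0 2 3 == isAbove x y 1 2 3)) (by
    simp [Fin.forall_fin_succ]
    grind)
  rw [hc,
    hy.triangleInd_of_lt hx (p := 0) (q := 2) (r := 3) (i := 1) (by decide) (by decide) (by decide),
    hy.triangleInd_of_gt hx (p := 0) (q := 1) (r := 3) (i := 2) (by decide) (by decide) (by decide),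
    eq_sub_iff_add_eq]
  exact_mod_cast h

/-- The combinatorial core for five points. If one point lies inside the hull of the four others,
it is in exactly two of the triangles with vertices among the other points, and if two points lie
inside the triangle `j` of the three others, each of them is in two triangles as well. Hence half
the number of pairs of a point and a triangle containing it is the number of points that are not
vertices of the hull, and subtracting `1` for a triangular hull gives the indicator function of the
complement of convex position. -/
theorem GenericPoints.convexInd_five {x y : Fin 5 → ℝ} (hy : GenericPoints x y)
    (hx : StrictMono x) :
    convexInd x y = 1 - (1 / 2 * (triangleInd x y 0 2 3 1 + triangleInd x y 0 1 3 2 +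
        triangleInd x y 1 3 4 2 + triangleInd x y 1 2 4 3) +
      (((1 / 2 * (triangleInd x y 0 1 4 2 + triangleInd x y 0 1 4 3) -
          triangleInd x y 0 1 4 2 * triangleInd x y 0 1 4 3) +
        (1 / 2 * (triangleInd x y 0 2 4 1 + triangleInd x y 0 2 4 3) -
          triangleInd x y 0 2 4 1 * triangleInd x y 0 2 4 3)) +
        (1 / 2 * (triangleInd x y 0 3 4 1 + triangleInd x y 0 3 4 2) -
          triangleInd x y 0 3 4 1 * triangleInd x y 0 3 4 2))) := by
  have hb : ∀ b012 b013 b014 b023 b024 b034 b123 b124 b134 b234 : Bool,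
      AtMostOneChange b012 b013 b023 b123 →
      AtMostOneChange b012 b014 b024 b124 →
      AtMostOneChange b013 b014 b034 b134 →
      AtMostOneChange b023 b024 b034 b234 →
      AtMostOneChange b123 b124 b134 b234 →
      2 * ((b012 == b013) && (b012 == b014) &&
        ((b023 == b024) && (b023 == b123) && (b023 == b124)) &&
        ((b034 == b134) && (b034 == b234))).toNat +
        ((b012 ^^ b013).toNat + (b123 ^^ b023).toNat + (b124 ^^ b024).toNat +
          (b134 ^^ b034).toNat + (b012 ^^ b014).toNat + (b234 ^^ b034).toNat +
          (b013 ^^ b014).toNat + (b023 ^^ b024).toNat + (b123 ^^ b124).toNat +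
          (b234 ^^ b134).toNat) =
      2 + 2 * ((b124 ^^ b024).toNat * (b134 ^^ b034).toNat +
        (b012 ^^ b014).toNat * (b234 ^^ b034).toNat +
        (b013 ^^ b014).toNat * (b023 ^^ b024).toNat) := by
    -- finite check over the values of the ten orientations
    decide +kernel
  have h := hb _ _ _ _ _ _ _ _ _ _
    (hy.atMostOneChange hx (p := 0) (q := 1) (r := 2) (s := 3) (by decide) (by decide)
      (by decide))
    (hy.atMostOneChange hx (p := 0) (q := 1) (r := 2) (s := 4) (by decide) (by decide)
      (by decide))
    (hy.atMostOneChange hx (p := 0) (q := 1) (r := 3) (s := 4) (by decide) (by decide)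
      (by decide))
    (hy.atMostOneChange hx (p := 0) (q := 2) (r := 3) (s := 4) (by decide) (by decide)
      (by decide))
    (hy.atMostOneChange hx (p := 1) (q := 2) (r := 3) (s := 4) (by decide) (by decide)
      (by decide))
  have hc := hy.convexInd_eq (b := (isAbove x y 0 1 2 == isAbove x y 0 1 3) &&
      (isAbove x y 0 1 2 == isAbove x y 0 1 4) &&
      ((isAbove x y 0 2 3 == isAbove x y 0 2 4) && (isAbove x y 0 2 3 == isAbove x y 1 2 3) &&
        (isAbove x y 0 2 3 == isAbove x y 1 2 4)) &&
      ((isAbove x y 0 3 4 == isAbove x y 1 3 4) && (isAbove x y 0 3 4 == isAbove x y 2 3 4))) (by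
    simp [Fin.forall_fin_succ]
    grind)
  rw [hc,
    hy.triangleInd_of_lt hx (p := 0) (q := 2) (r := 3) (i := 1) (by decide) (by decide) (by decide),
    hy.triangleInd_of_gt hx (p := 0) (q := 1) (r := 3) (i := 2) (by decide) (by decide) (by decide),
    hy.triangleInd_of_gt hx (p := 0) (q := 1) (r := 4) (i := 2) (by decide) (by decide) (by decide),
    hy.triangleInd_of_gt hx (p := 0) (q := 1) (r := 4) (i := 3) (by decide) (by decide) (by decide),
    hy.triangleInd_of_lt hx (p := 0) (q := 2) (r := 4) (i := 1) (by decide) (by decide) (by decide),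
    hy.triangleInd_of_gt hx (p := 0) (q := 2) (r := 4) (i := 3) (by decide) (by decide) (by decide),
    hy.triangleInd_of_lt hx (p := 0) (q := 3) (r := 4) (i := 1) (by decide) (by decide) (by decide),
    hy.triangleInd_of_lt hx (p := 0) (q := 3) (r := 4) (i := 2) (by decide) (by decide) (by decide),
    hy.triangleInd_of_lt hx (p := 1) (q := 3) (r := 4) (i := 2) (by decide) (by decide) (by decide),
    hy.triangleInd_of_gt hx (p := 1) (q := 2) (r := 4) (i := 3) (by decide) (by decide) (by decide)]
  have h' := congrArg (Nat.cast : ℕ → ℝ) h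
  push_cast at h'
  linarith

end Orientation

/-! ### Comparison of two configurations of segments with the same lengths -/

theorem ConvexSlices.ae_genericPoints {n : ℕ} {x a w : Fin n → ℝ} (H : ConvexSlices x a w) :
    ∀ᵐ t ∂cubeUniform n, GenericPoints x (ordinate a w t) := by
  simp only [GenericPoints, ae_all_iff]
  intro p q r h1 h2
  have hw := H.pos p q r h1 h2
  refine ae_cubeUniform_of_update q
    (isOpen_ne.preimage (continuous_dev_ordinate x a w p q r)).measurableSet fun t => ?_
  filter_upwards [(Set.countable_singleton
    ((chord x (ordinate a w t) p q r - a q) / w q)).ae_notMem unitUniform] with s hs h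
  rw [ordinate_update, dev_update_self _ _ h1.ne h2.ne'] at h
  refine hs (Set.mem_singleton_iff.2 ?_)
  rw [eq_div_iff hw.ne']
  linarith

/-- Both functions are integrable and the integral of the first one is at most that of the
second one. -/
def IntegralLE {α : Type*} [MeasurableSpace α] (μ : Measure α) (f g : α → ℝ) : Prop :=
  Integrable f μ ∧ Integrable g μ ∧ ∫ z, f z ∂μ ≤ ∫ z, g z ∂μ

namespace IntegralLE

variable {α : Type*} [MeasurableSpace α] {μ : Measure α} {f g f' g' : α → ℝ}

theorem add (h : IntegralLE μ f g) (h' : IntegralLE μ f' g') :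
    IntegralLE μ (fun z => f z + f' z) (fun z => g z + g' z) := by
  refine ⟨h.1.add h'.1, h.2.1.add h'.2.1, ?_⟩
  rw [integral_add h.1 h'.1, integral_add h.2.1 h'.2.1]
  exact add_le_add h.2.2 h'.2.2

theorem const_mul (h : IntegralLE μ f g) {c : ℝ} (hc : 0 ≤ c) :
    IntegralLE μ (fun z => c * f z) (fun z => c * g z) := by
  refine ⟨h.1.const_mul c, h.2.1.const_mul c, ?_⟩
  rw [integral_const_mul, integral_const_mul]
  exact mul_le_mul_of_nonneg_left h.2.2 hc

theorem one_sub [IsProbabilityMeasure μ] (h : IntegralLE μ f g) :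
    ∫ z, (1 - g z) ∂μ ≤ ∫ z, (1 - f z) ∂μ := by
  rw [integral_sub (integrable_const _) h.1, integral_sub (integrable_const _) h.2.1]
  exact sub_le_sub_left h.2.2 _

end IntegralLE

section Comparison

variable {n : ℕ} {x a a' w : Fin n → ℝ}

/-- A point falls into a triangle more likely when the midpoints of the segments that carry the
vertices of the triangle are farther from being aligned. -/
theorem ConvexSlices.integralLE_triangleInd (H : ConvexSlices x a w) (H' : ConvexSlices x a' w)
    {p q r i : Fin n} (h1 : p < q) (h2 : q < r) (h3 : p < i) (h4 : i < r) (hi : i ≠ q)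
    (hδ : dev x (midOrdinate a w) p q r ^ 2 ≤ dev x (midOrdinate a' w) p q r ^ 2) :
    IntegralLE (cubeUniform n) (fun t => triangleInd x (ordinate a w t) p q r i)
      (fun t => triangleInd x (ordinate a' w t) p q r i) := by
  refine ⟨integrable_triangleInd _ _ _ _ _ _ _, integrable_triangleInd _ _ _ _ _ _ _, ?_⟩
  rw [H.integral_triangleInd h1 h2 h3 h4 hi, H'.integral_triangleInd h1 h2 h3 h4 hi,
    H.integral_abs_dev h1 h2, H'.integral_abs_dev h1 h2]
  have hw := H.pos p q r h1 h2
  have := div_nonneg (tent_pos H.strictMono h1 h2 h3 h4).le (H.nonneg i)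
  gcongr

/-- The integral compared here is, up to a constant,
`((A + B) / (2 * w q) - A * B) * dev x (midOrdinate a w) p q r ^ 2`, where `A` and `B` are the
slopes of the probabilities of falling into the triangle with respect to its height. The
coefficient is nonnegative since a triangle of height `w q` fits in the convex set, that is, since
`A * w q` and `B * w q` are at most `1`. -/
theorem ConvexSlices.integralLE_triangleInd_pair (H : ConvexSlices x a w)
    (H' : ConvexSlices x a' w) {p q r i k : Fin n} (h1 : p < q) (h2 : q < r) (h3 : p < i)
    (h4 : i < r) (hi : i ≠ q) (h5 : p < k) (h6 : k < r) (hk : k ≠ q) (hik : i ≠ k)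
    (hδ : dev x (midOrdinate a w) p q r ^ 2 ≤ dev x (midOrdinate a' w) p q r ^ 2) :
    IntegralLE (cubeUniform n)
      (fun t => 1 / 2 * (triangleInd x (ordinate a w t) p q r i +
        triangleInd x (ordinate a w t) p q r k) -
        triangleInd x (ordinate a w t) p q r i * triangleInd x (ordinate a w t) p q r k)
      (fun t => 1 / 2 * (triangleInd x (ordinate a' w t) p q r i +
        triangleInd x (ordinate a' w t) p q r k) -
        triangleInd x (ordinate a' w t) p q r i * triangleInd x (ordinate a' w t) p q r k) := by
  have e1 : ∀ b, Integrable (fun t => 1 / 2 * (triangleInd x (ordinate b w t) p q r i +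
      triangleInd x (ordinate b w t) p q r k)) (cubeUniform n) := fun b =>
    ((integrable_triangleInd x b w p q r i).add (integrable_triangleInd x b w p q r k)).const_mul _
  have e2 : ∀ b, Integrable (fun t => triangleInd x (ordinate b w t) p q r i *
      triangleInd x (ordinate b w t) p q r k) (cubeUniform n) := fun b =>
    (integrable_triangleInd x b w p q r i).mul_triangleInd x b w p q r k
  have hw := H.pos p q r h1 h2
  have hint : ∀ {b : Fin n → ℝ}, ConvexSlices x b w →
      ∫ t, (1 / 2 * (triangleInd x (ordinate b w t) p q r i +
        triangleInd x (ordinate b w t) p q r k) -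
        triangleInd x (ordinate b w t) p q r i * triangleInd x (ordinate b w t) p q r k)
          ∂cubeUniform n =
      (1 / 2 * (tent x p q r i / w i + tent x p q r k / w k) / w q -
        tent x p q r i / w i * (tent x p q r k / w k)) * dev x (midOrdinate b w) p q r ^ 2 +
      (1 / 2 * (tent x p q r i / w i + tent x p q r k / w k) * (w q / 4 +
        (∫ t, chord x (ordinate (fun k => -(w k / 2)) w t) p q r ^ 2 ∂cubeUniform n) / w q) -
        tent x p q r i / w i * (tent x p q r k / w k) *
          ∫ t, dev x (ordinate (fun k => -(w k / 2)) w t) p q r ^ 2 ∂cubeUniform n) := by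
    intro b Hb
    rw [integral_sub (e1 b) (e2 b), integral_const_mul,
      integral_add (integrable_triangleInd _ _ _ _ _ _ _) (integrable_triangleInd _ _ _ _ _ _ _),
      Hb.integral_triangleInd h1 h2 h3 h4 hi, Hb.integral_triangleInd h1 h2 h5 h6 hk,
      Hb.integral_triangleInd_mul_triangleInd h1 h2 h3 h4 hi h5 h6 hk hik,
      Hb.integral_abs_dev h1 h2, integral_dev_sq x b w p q r]
    ring
  refine ⟨(e1 a).sub (e2 a), (e1 a').sub (e2 a'), ?_⟩
  rw [hint H, hint H']
  refine add_le_add_left (mul_le_mul_of_nonneg_left hδ ?_) _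
  have hwi := H.pos p i r h3 h4
  have hwk := H.pos p k r h5 h6
  have ti := H.tent_mul_le h1 h2 h3 h4 hi
  have tk := H.tent_mul_le h1 h2 h5 h6 hk
  have pi := div_nonneg (tent_pos H.strictMono h1 h2 h3 h4).le hwi.le
  have pk := div_nonneg (tent_pos H.strictMono h1 h2 h5 h6).le hwk.le
  rw [← div_le_one hwi, mul_div_right_comm] at ti
  rw [← div_le_one hwk, mul_div_right_comm] at tk
  rw [sub_nonneg, le_div_iff₀ hw]
  nlinarith [mul_le_mul_of_nonneg_left ti pk, mul_le_mul_of_nonneg_left tk pi]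

end Comparison

/-- Four points are less likely in convex position when the midpoints of the segments are farther
from being aligned. -/
theorem ConvexSlices.integral_convexInd_anti_four {x a a' w : Fin 4 → ℝ}
    (H : ConvexSlices x a w) (H' : ConvexSlices x a' w)
    (hδ : ∀ p q r, p < q → q < r →
      dev x (midOrdinate a w) p q r ^ 2 ≤ dev x (midOrdinate a' w) p q r ^ 2) :
    ∫ t, convexInd x (ordinate a' w t) ∂cubeUniform 4 ≤
      ∫ t, convexInd x (ordinate a w t) ∂cubeUniform 4 := by
  rw [integral_congr_ae (H.ae_genericPoints.mono fun t ht => ht.convexInd_four H.strictMono),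
    integral_congr_ae (H'.ae_genericPoints.mono fun t ht => ht.convexInd_four H.strictMono)]
  have key : ∀ p q r i : Fin 4, p < q → q < r → p < i → i < r → i ≠ q → _ :=
    fun p q r i h1 h2 h3 h4 h5 =>
      H.integralLE_triangleInd H' h1 h2 h3 h4 h5 (hδ p q r h1 h2)
  refine IntegralLE.one_sub (IntegralLE.add ?_ ?_) <;>
    exact key _ _ _ _ (by decide) (by decide) (by decide) (by decide) (by decide)

/-- Five points are less likely in convex position when the midpoints of the segments are farther
from being aligned. -/
theorem ConvexSlices.integral_convexInd_anti_five {x a a' w : Fin 5 → ℝ}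
    (H : ConvexSlices x a w) (H' : ConvexSlices x a' w)
    (hδ : ∀ p q r, p < q → q < r →
      dev x (midOrdinate a w) p q r ^ 2 ≤ dev x (midOrdinate a' w) p q r ^ 2) :
    ∫ t, convexInd x (ordinate a' w t) ∂cubeUniform 5 ≤
      ∫ t, convexInd x (ordinate a w t) ∂cubeUniform 5 := by
  rw [integral_congr_ae (H.ae_genericPoints.mono fun t ht => ht.convexInd_five H.strictMono),
    integral_congr_ae (H'.ae_genericPoints.mono fun t ht => ht.convexInd_five H.strictMono)]
  have key : ∀ p q r i : Fin 5, p < q → q < r → p < i → i < r → i ≠ q → _ :=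
    fun p q r i h1 h2 h3 h4 h5 =>
      H.integralLE_triangleInd H' h1 h2 h3 h4 h5 (hδ p q r h1 h2)
  have key' : ∀ p q r i k : Fin 5, p < q → q < r → p < i → i < r → i ≠ q → p < k → k < r →
      k ≠ q → i ≠ k → _ :=
    fun p q r i k h1 h2 h3 h4 h5 h6 h7 h8 h9 =>
      H.integralLE_triangleInd_pair H' h1 h2 h3 h4 h5 h6 h7 h8 h9 (hδ p q r h1 h2)
  refine IntegralLE.one_sub (IntegralLE.add (IntegralLE.const_mul (IntegralLE.add
    (IntegralLE.add (IntegralLE.add ?_ ?_) ?_) ?_) one_half_pos.le)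
    (IntegralLE.add (IntegralLE.add ?_ ?_) ?_))
  · exact key 0 2 3 1 (by decide) (by decide) (by decide) (by decide) (by decide)
  · exact key 0 1 3 2 (by decide) (by decide) (by decide) (by decide) (by decide)
  · exact key 1 3 4 2 (by decide) (by decide) (by decide) (by decide) (by decide)
  · exact key 1 2 4 3 (by decide) (by decide) (by decide) (by decide) (by decide)
  · exact key' 0 1 4 2 3 (by decide) (by decide) (by decide) (by decide) (by decide)
      (by decide) (by decide) (by decide) (by decide)
  · exact key' 0 2 4 1 3 (by decide) (by decide) (by decide) (by decide) (by decide)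
      (by decide) (by decide) (by decide) (by decide)
  · exact key' 0 3 4 1 2 (by decide) (by decide) (by decide) (by decide) (by decide)
      (by decide) (by decide) (by decide) (by decide)

/-! ### Reduction to the unit cube -/

theorem measurableSet_inConvexPosition_comp {n : ℕ} (x : Fin n → ℝ) {α : Type*}
    [MeasurableSpace α] {f : α → Fin n → ℝ} (hf : Measurable f) :
    MeasurableSet {z | InConvexPosition x (f z)} := by
  have hd : ∀ p q r, Measurable fun z => dev x (f z) p q r := by
    intro p q r
    unfold dev chord
    fun_prop
  simp only [InConvexPosition, Set.ofPred_forall, Set.ofPred_or]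
  refine MeasurableSet.iInter fun i => MeasurableSet.union ?_ ?_
  · exact MeasurableSet.iInter fun l => MeasurableSet.iInter fun r => MeasurableSet.iInter fun _ =>
      MeasurableSet.iInter fun _ => measurableSet_lt measurable_const (hd l i r)
  · exact MeasurableSet.iInter fun l => MeasurableSet.iInter fun r => MeasurableSet.iInter fun _ =>
      MeasurableSet.iInter fun _ => measurableSet_lt (hd l i r) measurable_const

theorem convexPositionProb_eq_integral {n : ℕ} {x : Fin n → ℝ} (hx : StrictMono x)
    (a w : Fin n → ℝ) :
    convexPositionProb (fun j => ((x j, a j), (x j, a j + w j))) =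
      ∫ t, convexInd x (ordinate a w t) ∂cubeUniform n := by
  set g : (Fin n → ℝ) → Fin n → ℝ × ℝ := fun t j =>
    (1 - t j) • (x j, a j) + t j • (x j, a j + w j) with hg
  have hgm : Measurable g := by fun_prop
  have hgo : ∀ t j, g t j = (x j, ordinate a w t j) := by
    intro t j
    simp only [hg, ordinate, Prod.smul_mk, Prod.mk_add_mk, smul_eq_mul, Prod.mk.injEq]
    constructor <;> ring
  have hmap : (Measure.pi fun j => segmentUniform ((x j, a j), (x j, a j + w j))) =
      (cubeUniform n).map g := by
    have := Measure.pi_map_pi (μ := fun _ : Fin n => unitUniform)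
      (f := fun j t => (1 - t) • (x j, a j) + t • (x j, a j + w j))
      (fun j => (by fun_prop : Measurable _).aemeasurable)
    exact this.symm
  -- the event is replaced by an almost surely equal one that is visibly measurable
  have hms : MeasurableSet {U : Fin n → ℝ × ℝ | InConvexPosition x fun j => (U j).2} :=
    measurableSet_inConvexPosition_comp x (by fun_prop)
  have hae : {U : Fin n → ℝ × ℝ | ConvexIndependent ℝ U} =ᵐ[(cubeUniform n).map g]
      {U : Fin n → ℝ × ℝ | InConvexPosition x fun j => (U j).2} := by
    have hfst : ∀ᵐ U ∂(cubeUniform n).map g, ∀ j, (U j).1 = x j := by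
      rw [ae_map_iff hgm.aemeasurable (by
        simp only [Set.ofPred_forall]
        exact MeasurableSet.iInter fun j => measurableSet_eq_fun (by fun_prop) measurable_const)]
      exact Filter.Eventually.of_forall fun t j => by rw [hgo]
    filter_upwards [hfst] with U hU
    refine propext ((convexIndependent_iff_dev hx fun j => (U j).2).symm.trans ?_).symm
    have : (fun j => (x j, (U j).2)) = U := funext fun j => Prod.ext (hU j).symm rfl
    rw [this]
    rfl
  rw [convexPositionProb, hmap, measureReal_congr hae, map_measureReal_apply hgm hms,
    ← integral_indicator_one (hgm hms)]
  congr 1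
  ext t
  classical
  rw [convexInd, Set.indicator_apply]
  refine if_congr ?_ rfl rfl
  simp only [Set.mem_preimage, Set.mem_ofPred_eq, hgo]

/-! ### Slices of a convex body -/

section Body

variable {H : Set (ℝ × ℝ)}

theorem isCompact_slice (hcomp : IsCompact H) (u : ℝ) : IsCompact {y : ℝ | (u, y) ∈ H} := by
  have : {y : ℝ | (u, y) ∈ H} = Prod.snd '' (H ∩ Prod.fst ⁻¹' {u}) := by
    ext y
    constructor
    · exact fun hy => ⟨(u, y), ⟨hy, rfl⟩, rfl⟩
    · rintro ⟨⟨b, c⟩, ⟨h1, h2⟩, rfl⟩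
      obtain rfl : b = u := h2
      exact h1
  rw [this]
  exact (hcomp.inter_right (isClosed_singleton.preimage continuous_fst)).image continuous_snd

theorem yLow_le_of_mem (hcomp : IsCompact H) {u v : ℝ} (h : (u, v) ∈ H) : yLow H u ≤ v :=
  csInf_le (isCompact_slice hcomp u).bddBelow h

theorem le_yHigh_of_mem (hcomp : IsCompact H) {u v : ℝ} (h : (u, v) ∈ H) : v ≤ yHigh H u :=
  le_csSup (isCompact_slice hcomp u).bddAbove h

theorem slice_nonempty (hconv : Convex ℝ H) (hcomp : IsCompact H) (hne : H.Nonempty) {u : ℝ}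
    (hu : u ∈ Set.Icc (xMin H) (xMax H)) : {y : ℝ | (u, y) ∈ H}.Nonempty := by
  have hc : IsCompact (Prod.fst '' H) := hcomp.image continuous_fst
  have hcv : Convex ℝ (Prod.fst '' H) := hconv.linear_image (LinearMap.fst ℝ ℝ ℝ)
  have h1 := hc.sInf_mem (hne.image _)
  have h2 := hc.sSup_mem (hne.image _)
  obtain ⟨⟨b, c⟩, h3, rfl⟩ := hcv.ordConnected.out h1 h2 hu
  exact ⟨c, h3⟩

theorem yLow_mem (hconv : Convex ℝ H) (hcomp : IsCompact H) (hne : H.Nonempty) {u : ℝ}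
    (hu : u ∈ Set.Icc (xMin H) (xMax H)) : (u, yLow H u) ∈ H :=
  (isCompact_slice hcomp u).sInf_mem (slice_nonempty hconv hcomp hne hu)

theorem yHigh_mem (hconv : Convex ℝ H) (hcomp : IsCompact H) (hne : H.Nonempty) {u : ℝ}
    (hu : u ∈ Set.Icc (xMin H) (xMax H)) : (u, yHigh H u) ∈ H :=
  (isCompact_slice hcomp u).sSup_mem (slice_nonempty hconv hcomp hne hu)

theorem width_nonneg (hconv : Convex ℝ H) (hcomp : IsCompact H) (hne : H.Nonempty) (u : ℝ) :
    0 ≤ width H u :=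
  Set.indicator_nonneg (fun _ hv =>
    sub_nonneg.2 (yLow_le_of_mem hcomp (yHigh_mem hconv hcomp hne hv))) u

theorem yHigh_eq_yLow_add_width {u : ℝ} (hu : u ∈ Set.Icc (xMin H) (xMax H)) :
    yHigh H u = yLow H u + width H u := by
  rw [width, Set.indicator_of_mem hu]
  ring

theorem convexOn_yLow (hconv : Convex ℝ H) (hcomp : IsCompact H) (hne : H.Nonempty) :
    ConvexOn ℝ (Set.Icc (xMin H) (xMax H)) (yLow H) :=
  ⟨convex_Icc _ _, fun _ hu _ hv _ _ hs ht hst => yLow_le_of_mem hcomp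
    (hconv (yLow_mem hconv hcomp hne hu) (yLow_mem hconv hcomp hne hv) hs ht hst)⟩

theorem concaveOn_yHigh (hconv : Convex ℝ H) (hcomp : IsCompact H) (hne : H.Nonempty) :
    ConcaveOn ℝ (Set.Icc (xMin H) (xMax H)) (yHigh H) :=
  ⟨convex_Icc _ _, fun _ hu _ hv _ _ hs ht hst => le_yHigh_of_mem hcomp
    (hconv (yHigh_mem hconv hcomp hne hu) (yHigh_mem hconv hcomp hne hv) hs ht hst)⟩

theorem concaveOn_width (hconv : Convex ℝ H) (hcomp : IsCompact H) (hne : H.Nonempty) :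
    ConcaveOn ℝ (Set.Icc (xMin H) (xMax H)) (width H) :=
  ((concaveOn_yHigh hconv hcomp hne).sub (convexOn_yLow hconv hcomp hne)).congr fun u hu => by
    rw [width, Set.indicator_of_mem hu]
    rfl

theorem width_pos (hconv : Convex ℝ H) (hcomp : IsCompact H) (hint : (interior H).Nonempty)
    {u : ℝ} (hu : u ∈ Set.Ioo (xMin H) (xMax H)) : 0 < width H u := by
  obtain ⟨⟨c, d⟩, hcd⟩ := hint
  have hne : H.Nonempty := ⟨_, interior_subset hcd⟩
  have hcI : c ∈ Set.Icc (xMin H) (xMax H) := by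
    have hb := (hcomp.image continuous_fst)
    exact ⟨csInf_le hb.bddBelow ⟨_, interior_subset hcd, rfl⟩,
      le_csSup hb.bddAbove ⟨_, interior_subset hcd, rfl⟩⟩
  -- the slice through an interior point is not reduced to a point
  have hc : 0 < width H c := by
    have hev : ∀ᶠ v in nhds d, (c, v) ∈ H :=
      (Continuous.prodMk_right c).continuousAt.eventually (mem_interior_iff_mem_nhds.1 hcd)
    obtain ⟨ε, hε, hball⟩ := Metric.eventually_nhds_iff.1 hev
    have h1 := le_yHigh_of_mem hcomp (hball (y := d + ε / 2) (by
      rw [Real.dist_eq, add_sub_cancel_left, abs_of_pos (by positivity)]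
      linarith))
    have h2 := yLow_le_of_mem hcomp (interior_subset hcd)
    rw [width, Set.indicator_of_mem hcI]
    linarith
  have hcc := concaveOn_width hconv hcomp hne
  have hmin : xMin H ∈ Set.Icc (xMin H) (xMax H) := ⟨le_rfl, (hu.1.trans hu.2).le⟩
  have hmax : xMax H ∈ Set.Icc (xMin H) (xMax H) := ⟨(hu.1.trans hu.2).le, le_rfl⟩
  rcases lt_trichotomy u c with h | rfl | h
  · have h1 := sub_pos.2 h
    have h2 := sub_pos.2 hu.1
    have h3 := sub_pos.2 (hu.1.trans h)
    have := hcc.2 hmin hcI (div_nonneg h1.le h3.le) (div_nonneg h2.le h3.le)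
      (by field_simp; ring)
    have hcomb : ((c - u) / (c - xMin H)) • xMin H + ((u - xMin H) / (c - xMin H)) • c = u := by
      simp only [smul_eq_mul]
      field_simp
      ring
    rw [hcomb] at this
    refine lt_of_lt_of_le (add_pos_of_nonneg_of_pos ?_ ?_) this
    · exact mul_nonneg (by positivity) (width_nonneg hconv hcomp hne _)
    · exact mul_pos (by positivity) hc
  · exact hc
  · have h1 := sub_pos.2 h
    have h2 := sub_pos.2 hu.2
    have h3 := sub_pos.2 (h.trans hu.2)
    have := hcc.2 hcI hmax (div_nonneg h2.le h3.le) (div_nonneg h1.le h3.le)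
      (by field_simp; ring)
    have hcomb : ((xMax H - u) / (xMax H - c)) • c + ((u - c) / (xMax H - c)) • xMax H = u := by
      simp only [smul_eq_mul]
      field_simp
      ring
    rw [hcomb] at this
    refine lt_of_lt_of_le (add_pos_of_pos_of_nonneg ?_ ?_) this
    · exact mul_pos (by positivity) hc
    · exact mul_nonneg (by positivity) (width_nonneg hconv hcomp hne _)

theorem verticalSlice_shaking (hconv : Convex ℝ H) (hcomp : IsCompact H) (hne : H.Nonempty) {u : ℝ}
    (hu : u ∈ Set.Icc (xMin H) (xMax H)) :
    verticalSlice (shaking H) u = ((u, 0), (u, 0 + width H u)) := by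
  have h0 := width_nonneg hconv hcomp hne u
  have h : {y : ℝ | (u, y) ∈ shaking H} = Set.Icc 0 (width H u) := by
    ext y
    simp [shaking, hu.1, hu.2]
  rw [verticalSlice, yLow, yHigh, h, csInf_Icc h0, csSup_Icc h0, zero_add]

theorem verticalSlice_steinerSym (hconv : Convex ℝ H) (hcomp : IsCompact H) (hne : H.Nonempty)
    {u : ℝ} (hu : u ∈ Set.Icc (xMin H) (xMax H)) :
    verticalSlice (steinerSym H) u =
      ((u, -(width H u / 2)), (u, -(width H u / 2) + width H u)) := by
  have h0 := width_nonneg hconv hcomp hne u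
  have h : {y : ℝ | (u, y) ∈ steinerSym H} = Set.Icc (-(width H u / 2)) (width H u / 2) := by
    ext y
    simp [steinerSym, hu.1, hu.2, abs_le]
  rw [verticalSlice, yLow, yHigh, h, csInf_Icc (by linarith), csSup_Icc (by linarith)]
  congr 2
  ring

theorem verticalSlice_eq_yLow_add_width {u : ℝ} (hu : u ∈ Set.Icc (xMin H) (xMax H)) :
    verticalSlice H u = ((u, yLow H u), (u, yLow H u + width H u)) := by
  rw [verticalSlice, yHigh_eq_yLow_add_width hu]

theorem ConvexOn.dev_nonpos {s : Set ℝ} {f : ℝ → ℝ} (hf : ConvexOn ℝ s f) {n : ℕ}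
    {x : Fin n → ℝ} (hx : StrictMono x) (hs : ∀ j, x j ∈ s) {p q r : Fin n} (h1 : p < q)
    (h2 : q < r) : dev x (fun j => f (x j)) p q r ≤ 0 := by
  have e1 := sub_pos.2 (hx h1)
  have e2 := sub_pos.2 (hx h2)
  have e3 := sub_pos.2 (hx (h1.trans h2))
  have h := hf.2 (hs p) (hs r) (div_nonneg e2.le e3.le) (div_nonneg e1.le e3.le)
    (by field_simp; ring)
  have hcomb : ((x r - x q) / (x r - x p)) • x p + ((x q - x p) / (x r - x p)) • x r = x q := by
    simp only [smul_eq_mul]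
    field_simp
    ring
  rw [hcomb] at h
  have hchord : chord x (fun j => f (x j)) p q r =
      ((x r - x q) / (x r - x p)) • f (x p) + ((x q - x p) / (x r - x p)) • f (x r) := by
    simp only [smul_eq_mul, chord]
    ring
  rw [dev, hchord]
  linarith

theorem ConcaveOn.dev_nonneg {s : Set ℝ} {f : ℝ → ℝ} (hf : ConcaveOn ℝ s f) {n : ℕ}
    {x : Fin n → ℝ} (hx : StrictMono x) (hs : ∀ j, x j ∈ s) {p q r : Fin n} (h1 : p < q)
    (h2 : q < r) : 0 ≤ dev x (fun j => f (x j)) p q r := by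
  have h := hf.neg.dev_nonpos hx hs h1 h2
  have h' := dev_neg x (fun j => f (x j)) p q r
  have : (-fun j => f (x j)) = fun j => (-f) (x j) := rfl
  rw [← this, h'] at h
  linarith

theorem dev_const_mul {ι : Type*} (x y : ι → ℝ) (c : ℝ) (p q r : ι) :
    dev x (fun j => c * y j) p q r = c * dev x y p q r := by
  unfold dev chord
  ring

/-- Segments with concave lengths are in convex position when each of them is shifted down from
the axis by the same fraction of its length. -/
theorem convexSlices_const_mul {n : ℕ} {x w : Fin n → ℝ} (hx : StrictMono x) (hw : ∀ j, 0 ≤ w j)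
    (hpos : ∀ p q r, p < q → q < r → 0 < w q)
    (hdev : ∀ p q r, p < q → q < r → 0 ≤ dev x w p q r) {c : ℝ} (hc : c ≤ 0) (hc' : -1 ≤ c) :
    ConvexSlices x (fun j => c * w j) w where
  strictMono := hx
  nonneg := hw
  pos := hpos
  lower p q r h1 h2 := by
    rw [dev_const_mul]
    exact mul_nonpos_of_nonpos_of_nonneg hc (hdev p q r h1 h2)
  upper p q r h1 h2 := by
    rw [dev_add, dev_const_mul]
    nlinarith [hdev p q r h1 h2]

end Body

/-! ### Comparison with the shaking and the Steiner symmetrization -/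

theorem mainTheorem3 (H : Set (ℝ × ℝ)) (hconv : Convex ℝ H) (hcomp : IsCompact H)
    (hint : (interior H).Nonempty) (N : ℕ) (hN : N = 2 ∨ N = 3) (x : Fin (N + 2) → ℝ)
    (hmono : StrictMono x) (hx : ∀ j, x j ∈ Set.Icc (xMin H) (xMax H)) :
    convexPositionProb (fun j => verticalSlice (shaking H) (x j)) ≤
        convexPositionProb (fun j => verticalSlice H (x j)) ∧
      convexPositionProb (fun j => verticalSlice H (x j)) ≤
        convexPositionProb (fun j => verticalSlice (steinerSym H) (x j)) := by
  have hne : H.Nonempty := hint.mono interior_subset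
  set w : Fin (N + 2) → ℝ := fun j => width H (x j) with hw
  set a : Fin (N + 2) → ℝ := fun j => yLow H (x j) with ha
  have hw0 : ∀ j, 0 ≤ w j := fun j => width_nonneg hconv hcomp hne _
  have hwpos : ∀ p q r, p < q → q < r → 0 < w q := fun p q r h1 h2 =>
    width_pos hconv hcomp hint
      ⟨(hx p).1.trans_lt (hmono h1), (hmono h2).trans_le (hx r).2⟩
  have hdev : ∀ p q r, p < q → q < r → 0 ≤ dev x w p q r := fun p q r h1 h2 =>
    (concaveOn_width hconv hcomp hne).dev_nonneg hmono hx h1 h2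
  have hlow : ∀ p q r, p < q → q < r → dev x a p q r ≤ 0 := fun p q r h1 h2 =>
    (convexOn_yLow hconv hcomp hne).dev_nonpos hmono hx h1 h2
  have hhigh : ∀ p q r, p < q → q < r → 0 ≤ dev x a p q r + dev x w p q r := by
    intro p q r h1 h2
    have h := (concaveOn_yHigh hconv hcomp hne).dev_nonneg hmono hx h1 h2
    simp only [fun j => yHigh_eq_yLow_add_width (hx j)] at h
    rwa [dev_add] at h
  have hH : ConvexSlices x a w := ⟨hmono, hw0, hwpos, hlow, fun p q r h1 h2 => by
    rw [dev_add]
    exact hhigh p q r h1 h2⟩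
  have hSha := convexSlices_const_mul hmono hw0 hwpos hdev le_rfl (by norm_num : (-1 : ℝ) ≤ 0)
  have hSym := convexSlices_const_mul hmono hw0 hwpos hdev (by norm_num : (-1 / 2 : ℝ) ≤ 0)
    (by norm_num)
  have hmid : ∀ (b : Fin (N + 2) → ℝ) (p q r : Fin (N + 2)),
      dev x (midOrdinate b w) p q r = dev x b p q r + 1 / 2 * dev x w p q r := by
    intro b p q r
    rw [← dev_const_mul, ← dev_add]
    congr 1
    ext j
    unfold midOrdinate
    ring
  have h1 : ∀ p q r, p < q → q < r → dev x (midOrdinate a w) p q r ^ 2 ≤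
      dev x (midOrdinate (fun j => 0 * w j) w) p q r ^ 2 := by
    intro p q r h1 h2
    rw [hmid, hmid, dev_const_mul]
    have := hlow p q r h1 h2
    have := hhigh p q r h1 h2
    exact sq_le_sq' (by linarith) (by linarith)
  have h2 : ∀ p q r, p < q → q < r → dev x (midOrdinate (fun j => -1 / 2 * w j) w) p q r ^ 2 ≤
      dev x (midOrdinate a w) p q r ^ 2 := by
    intro p q r h1 h2
    rw [hmid, dev_const_mul]
    have : -1 / 2 * dev x w p q r + 1 / 2 * dev x w p q r = 0 := by ring
    rw [this, zero_pow two_ne_zero]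
    exact sq_nonneg _
  have eSha : (fun j => verticalSlice (shaking H) (x j)) =
      fun j => ((x j, 0 * w j), (x j, 0 * w j + w j)) := by
    ext1 j
    rw [verticalSlice_shaking hconv hcomp hne (hx j), zero_mul]
  have eSym : (fun j => verticalSlice (steinerSym H) (x j)) =
      fun j => ((x j, -1 / 2 * w j), (x j, -1 / 2 * w j + w j)) := by
    ext1 j
    have : -(width H (x j) / 2) = -1 / 2 * w j := by
      rw [hw]
      ring
    rw [verticalSlice_steinerSym hconv hcomp hne (hx j), this]
  have eH : (fun j => verticalSlice H (x j)) = fun j => ((x j, a j), (x j, a j + w j)) :=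
    funext fun j => verticalSlice_eq_yLow_add_width (hx j)
  rw [eSha, eSym, eH, convexPositionProb_eq_integral hmono, convexPositionProb_eq_integral hmono,
    convexPositionProb_eq_integral hmono]
  clear_value a w
  rcases hN with rfl | rfl
  · exact ⟨hH.integral_convexInd_anti_four hSha h1, hSym.integral_convexInd_anti_four hH h2⟩
  · exact ⟨hH.integral_convexInd_anti_five hSha h1, hSym.integral_convexInd_anti_five hH h2⟩
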